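/- A bidirected graph $B$ is a loopless multigraph (finite or infinite) together with a map $\sigma$ that assigns a sign $\sigma(e,u)\in\{+,-\}$ to every pair of an edge $e$ and an endpoint $u$ of $e$. A trail in $B$ is a finite sequence $v_0e_1v_1e_2v_2\dots v_{\ell-1}e_\ell v_\ell$ with $\ell\ge 0$, where the $e_i$ are pairwise distinct edges of $B$, the edge $e_i$ has endpoints $v_{i-1}$ and $v_i$, and $\sigma(e_{i+1},v_i)=-\sigma(e_i,v_i)$ for $1\le i\le \ell-1$; it is trivial if $\ell=0$. A path is a trail that does not repeat vertices; $v_0$ is its first vertex, $v_\ell$ its last vertex, and these are its endpoints. For vertex sets $X,Y$, an $X$--$Y$ path is a path whose first vertex is its unique vertex in $X$ and whose last vertex is its unique vertex in $Y$. Let $B$ be a bidirected graph, and let $X$ and $Y$ be sets of vertices of $B$ such that there is no nontrivial path in $B$ with both endpoints in $X$. Let $\mathcal{P}$ and $\mathcal{Q}$ be sets of pairwise vertex-disjoint $X$--$Y$ paths in $B$. Then there is a set $\mathcal{R}$ of pairwise vertex-disjoint $X$--$Y$ paths in $B$ such that every first vertex of a path in $\mathcal{P}$ is the first vertex of a path in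 $\mathcal{R}$, and every last vertex of a path in $\mathcal{Q}$ is the last vertex of a path in $\mathcal{R}$. -/

import Mathlib

/-- A bidirected graph with vertex set `V` and edge set `E`: a loopless multigraph (no finiteness
is assumed) together with a sign `+` or `-`, that is, an element `1` or `-1` of `ℤˣ`, at each
half-edge `(e, u)`, where `u` is an endpoint of `e`. -/
structure BidirectedGraph (V : Type*) (E : Type*) where
  /-- the two endpoints of an edge -/
  ends : E → Sym2 V
  loopless : ∀ e, ¬ (ends e).IsDiag
  /-- the sign `σ(e, u)` of the half-edge `(e, u)` -/
  sign : {h : E × V // h.2 ∈ ends h.1} → ℤˣ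

namespace BidirectedGraph

variable {V E : Type*}

/-- An oriented edge: a triple `(e, u, v)` where `e` is an edge with endpoints `u` and `v`. -/
structure OrientedEdge (B : BidirectedGraph V E) where
  edge : E
  tail : V
  head : V
  ends_eq : B.ends edge = s(tail, head)

/-- The sign of the underlying edge at the tail. -/
def OrientedEdge.tailSign {B : BidirectedGraph V E} (a : B.OrientedEdge) : ℤˣ :=
  B.sign ⟨(a.edge, a.tail), by rw [a.ends_eq]; exact Sym2.mem_mk_left _ _⟩

/-- The sign of the underlying edge at the head. -/
def OrientedEdge.headSign {B : BidirectedGraph V E} (a : B.OrientedEdge) : ℤˣ :=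
  B.sign ⟨(a.edge, a.head), by rw [a.ends_eq]; exact Sym2.mem_mk_right _ _⟩

/-- A trail `v₀ e₁ v₁ … eₗ vₗ`, recorded by its initial vertex `v₀` and the list of its oriented
edges: consecutive oriented edges fit together and have opposite signs at their common vertex,
and no edge is used twice. The list is empty exactly for trivial trails. -/
structure Trail (B : BidirectedGraph V E) where
  first : V
  oedges : List B.OrientedEdge
  tail_head : ∀ a ∈ oedges.head?, a.tail = first
  chain : oedges.IsChain fun a b => a.head = b.tail ∧ b.tailSign = -a.headSign
  edges_nodup : (oedges.map OrientedEdge.edge).Nodup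

namespace Trail

variable {B : BidirectedGraph V E}

/-- The vertices `v₀, v₁, …, vₗ` of a trail, in order. -/
def vertices (T : B.Trail) : List V :=
  T.first :: T.oedges.map OrientedEdge.head

/-- The last vertex of a trail. -/
def last (T : B.Trail) : V :=
  T.vertices.getLast (List.cons_ne_nil _ _)

/-- A trail is trivial if it consists of a single vertex. -/
def IsTrivial (T : B.Trail) : Prop :=
  T.oedges = []

/-- A path is a trail that does not repeat vertices. -/
def IsPath (T : B.Trail) : Prop :=
  T.vertices.Nodup

/-- An `X`--`Y` path: a path whose first vertex is its unique vertex in `X` and whose last vertex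
is its unique vertex in `Y`. -/
def IsPathFromTo (T : B.Trail) (X Y : Set V) : Prop :=
  T.IsPath ∧
  (T.first ∈ X ∧ ∀ v ∈ T.vertices, v ∈ X → v = T.first) ∧
  (T.last ∈ Y ∧ ∀ v ∈ T.vertices, v ∈ Y → v = T.last)

end Trail

/-- `𝓟` is a set of (pairwise) vertex-disjoint `X`--`Y` paths. -/
def IsDisjointPathSet (B : BidirectedGraph V E) (X Y : Set V) (𝓟 : Set B.Trail) : Prop :=
  (∀ T ∈ 𝓟, T.IsPathFromTo X Y) ∧
  𝓟.Pairwise fun S T => ∀ v ∈ S.vertices, v ∉ T.vertices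

end BidirectedGraph

/-! The argument resembles deferred acceptance. Each path `P` of `𝓟` is cut to an initial segment
ending at its vertex `s P`, so that every `Q` in `𝓠` met by these segments is held: its last met
vertex is the end of some segment, and the signs allow continuing along `Q` from there. Length-zero
segments have this property, and pointwise suprema preserve it, so Zorn's lemma yields a maximal
`s`.

At a maximal `s`, every `P` holding nothing is used in full (`Valid.eq_len_of_maximal`). Otherwise
its segment could grow by one edge. This could fail only if the new vertex lay on some `Q` beyond
all met vertices, with the wrong sign for continuing along `Q`. Then the segment of `P` and the edge
of `Q` arriving there have opposite signs, and going back along `Q`, either to its first vertex or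
to the holding vertex and then back along the holding segment, gives a nontrivial path between two
vertices of `X` (`Valid.signs_of_new_top`).

The family sought consists of the splices of holders with the paths they hold, the paths of `𝓟`
holding nothing, and the paths of `𝓠` not met. -/

namespace BidirectedGraph

variable {V E : Type*} {B : BidirectedGraph V E}

/-- The same edge, traversed in the opposite direction. -/
def OrientedEdge.flip (a : B.OrientedEdge) : B.OrientedEdge :=
  ⟨a.edge, a.head, a.tail, by rw [a.ends_eq, Sym2.eq_swap]⟩

/-! ### Trails: indexed vertices, segments, concatenation and reversal. -/

namespace Trail

/-- The number of edges of a trail. -/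
def len (T : B.Trail) : ℕ := T.oedges.length

/-- The `i`-th vertex of a trail (junk for `i > T.len`). -/
def vtx (T : B.Trail) (i : ℕ) : V := T.vertices.getD i T.first

theorem length_vertices (T : B.Trail) : T.vertices.length = T.len + 1 := by
  simp [vertices, len]

theorem vtx_eq_getElem (T : B.Trail) {i : ℕ} (h : i ≤ T.len) :
    T.vtx i = T.vertices[i]'(by rw [length_vertices]; omega) := by
  simp [vtx, List.getD_eq_getElem?_getD, length_vertices, Nat.lt_succ_of_le h]

theorem vtx_zero (T : B.Trail) : T.vtx 0 = T.first := by
  simp [vtx, vertices]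

theorem getLast?_vertices (T : B.Trail) : T.vertices.getLast? = some T.last :=
  List.getLast?_eq_some_getLast _

theorem vtx_len (T : B.Trail) : T.vtx T.len = T.last := by
  rw [vtx_eq_getElem T le_rfl, ← Option.some_inj, ← getLast?_vertices,
    List.getLast?_eq_getElem?]
  simp [length_vertices]

theorem mem_vertices_iff {T : B.Trail} {v : V} : v ∈ T.vertices ↔ ∃ i ≤ T.len, T.vtx i = v := by
  rw [List.mem_iff_getElem]
  constructor
  · rintro ⟨i, h, rfl⟩
    have : i ≤ T.len := by rw [length_vertices] at h; omega
    exact ⟨i, this, vtx_eq_getElem T this⟩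
  · rintro ⟨i, h, rfl⟩
    exact ⟨i, by rw [length_vertices]; omega, (vtx_eq_getElem T h).symm⟩

theorem vtx_mem {T : B.Trail} {i : ℕ} (h : i ≤ T.len) : T.vtx i ∈ T.vertices :=
  mem_vertices_iff.2 ⟨i, h, rfl⟩

theorem first_mem (T : B.Trail) : T.first ∈ T.vertices := List.mem_cons_self

theorem last_mem (T : B.Trail) : T.last ∈ T.vertices := List.getLast_mem _

theorem IsPath.vtx_inj {T : B.Trail} (hT : T.IsPath) {i j : ℕ} (hi : i ≤ T.len) (hj : j ≤ T.len)
    (h : T.vtx i = T.vtx j) : i = j := by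
  rw [vtx_eq_getElem T hi, vtx_eq_getElem T hj] at h
  exact (List.Nodup.getElem_inj_iff hT).1 h

theorem head_getElem (T : B.Trail) {i : ℕ} (h : i < T.len) :
    (T.oedges[i]'h).head = T.vtx (i + 1) := by
  rw [vtx_eq_getElem T (show i + 1 ≤ T.len from h)]
  simp only [vertices, List.getElem_cons_succ, List.getElem_map]
  rfl

theorem tail_getElem (T : B.Trail) {i : ℕ} (h : i < T.len) : (T.oedges[i]'h).tail = T.vtx i := by
  cases i with
  | zero =>
    rw [vtx_zero]
    exact T.tail_head _ (by rw [List.head?_eq_getElem?]; exact List.getElem?_eq_getElem h)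
  | succ i =>
    have h' : i < T.len := by omega
    rw [← head_getElem T h']
    exact ((List.isChain_iff_getElem.1 T.chain) i h).1.symm

theorem tailSign_getElem_succ (T : B.Trail) {i : ℕ} (h : i + 1 < T.len) :
    (T.oedges[i + 1]'h).tailSign = -(T.oedges[i]'(Nat.lt_of_succ_lt h)).headSign :=
  ((List.isChain_iff_getElem.1 T.chain) i h).2

/-- The subtrail between the `i`-th and the `j`-th vertex. -/
def seg (T : B.Trail) (i j : ℕ) : B.Trail where
  first := T.vtx i
  oedges := (T.oedges.take j).drop i
  tail_head := by
    intro a ha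
    rw [List.head?_drop, Option.mem_def, List.getElem?_eq_some_iff] at ha
    obtain ⟨h, rfl⟩ := ha
    rw [List.getElem_take]
    exact T.tail_getElem (by rw [List.length_take] at h; exact lt_of_lt_of_le h (min_le_right _ _))
  chain := (T.chain.take j).drop i
  edges_nodup := T.edges_nodup.sublist
    (((List.drop_sublist _ _).trans (List.take_sublist _ _)).map _)

theorem seg_first (T : B.Trail) (i j : ℕ) : (T.seg i j).first = T.vtx i := rfl

theorem seg_vertices (T : B.Trail) {i j : ℕ} (hij : i ≤ j) (hj : j ≤ T.len) :
    (T.seg i j).vertices = (T.vertices.take (j + 1)).drop i := by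
  have h : i < (T.vertices.take (j + 1)).length := by
    rw [List.length_take, length_vertices]; omega
  rw [List.drop_eq_getElem_cons h, List.getElem_take, ← vtx_eq_getElem T (hij.trans hj)]
  simp [vertices, seg, List.map_drop, List.map_take]

theorem IsPath.seg {T : B.Trail} (hT : T.IsPath) {i j : ℕ} (hij : i ≤ j) (hj : j ≤ T.len) :
    (T.seg i j).IsPath := by
  rw [IsPath, seg_vertices T hij hj]
  exact List.Nodup.sublist ((List.drop_sublist _ _).trans (List.take_sublist _ _)) hT

theorem seg_len (T : B.Trail) {i j : ℕ} (hj : j ≤ T.len) : (T.seg i j).len = j - i := by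
  have : j ≤ T.oedges.length := hj
  simp [len, seg, this]

theorem seg_vtx (T : B.Trail) {i j k : ℕ} (hij : i ≤ j) (hj : j ≤ T.len) (hk : k ≤ j - i) :
    (T.seg i j).vtx k = T.vtx (i + k) := by
  rw [vtx_eq_getElem _ (by rw [seg_len T hj]; exact hk), vtx_eq_getElem T (by omega)]
  simp [seg_vertices T hij hj]

theorem seg_last (T : B.Trail) {i j : ℕ} (hij : i ≤ j) (hj : j ≤ T.len) :
    (T.seg i j).last = T.vtx j := by
  rw [← vtx_len, seg_len T hj, seg_vtx T hij hj le_rfl]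
  congr 1; omega

theorem mem_seg {T : B.Trail} {i j : ℕ} (hij : i ≤ j) (hj : j ≤ T.len) {v : V} :
    v ∈ (T.seg i j).vertices ↔ ∃ k, i ≤ k ∧ k ≤ j ∧ T.vtx k = v := by
  rw [mem_vertices_iff, seg_len T hj]
  constructor
  · rintro ⟨k, hk, rfl⟩
    exact ⟨i + k, by omega, by omega, (seg_vtx T hij hj hk).symm⟩
  · rintro ⟨k, h1, h2, rfl⟩
    exact ⟨k - i, by omega, by rw [seg_vtx T hij hj (by omega)]; congr 1; omega⟩

theorem mem_of_mem_seg {T : B.Trail} {i j : ℕ} (hij : i ≤ j) (hj : j ≤ T.len) {v : V}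
    (h : v ∈ (T.seg i j).vertices) : v ∈ T.vertices := by
  obtain ⟨k, _, h2, rfl⟩ := (mem_seg hij hj).1 h
  exact vtx_mem (h2.trans hj)

theorem seg_head? (T : B.Trail) {i j : ℕ} (hij : i < j) :
    (T.seg i j).oedges.head? = T.oedges[i]? := by
  simp [seg, List.head?_drop, hij]

theorem seg_getLast? (T : B.Trail) {i j : ℕ} (hij : i ≤ j) (hj : j < T.len) :
    (T.seg i (j + 1)).oedges.getLast? = T.oedges[j]? := by
  have h : j + 1 ≤ T.oedges.length := hj
  have h' : ¬ j < i := by omega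
  simp only [seg, List.getLast?_drop, List.length_take, List.getLast?_take]
  simp [h, h', List.getElem?_eq_getElem (show j < T.oedges.length from hj)]

/-- Two trails can be concatenated: they fit together and only meet at the junction. -/
structure Joins (S T : B.Trail) : Prop where
  last_eq : S.last = T.first
  signs : ∀ a ∈ S.oedges.getLast?, ∀ b ∈ T.oedges.head?, b.tailSign = -a.headSign
  inter : ∀ v ∈ S.vertices, v ∈ T.vertices → v = S.last

/-- The first edge contains `u`, whereas all ends of later edges lie among the later vertices. The
second conclusion records this so that the induction goes through. -/
theorem edges_nodup_of_vertices_nodup (l : List B.OrientedEdge) (u : V)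
    (hu : ∀ a ∈ l.head?, a.tail = u)
    (hl : l.IsChain fun a b => a.head = b.tail ∧ b.tailSign = -a.headSign)
    (hn : (u :: l.map OrientedEdge.head).Nodup) :
    (l.map OrientedEdge.edge).Nodup ∧
      ∀ a ∈ l, ∀ v ∈ B.ends a.edge, v ∈ u :: l.map OrientedEdge.head := by
  induction l generalizing u with
  | nil => simp
  | cons a l ih =>
    have ha : a.tail = u := hu a (by simp)
    rw [List.isChain_cons] at hl
    have hn' := (List.nodup_cons.1 hn)
    obtain ⟨h1, h2⟩ := ih a.head (fun b hb => (hl.1 b hb).1.symm) hl.2 hn'.2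
    refine ⟨?_, ?_⟩
    · rw [List.map_cons, List.nodup_cons]
      refine ⟨fun h => ?_, h1⟩
      obtain ⟨b, hb, hab⟩ := List.mem_map.1 h
      refine hn'.1 (h2 b hb u ?_)
      rw [hab, a.ends_eq, ha]
      exact Sym2.mem_mk_left _ _
    · intro b hb v hv
      rcases List.mem_cons.1 hb with rfl | hb
      · rw [b.ends_eq, Sym2.mem_iff, ha] at hv
        rcases hv with rfl | rfl <;> simp
      · exact List.mem_cons_of_mem _ (h2 b hb v hv)

theorem last_eq_getLast? (T : B.Trail) :
    T.last = (T.oedges.getLast?.map OrientedEdge.head).getD T.first := by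
  rw [← Option.some_inj, ← getLast?_vertices, vertices, List.getLast?_cons, List.getLast?_map]

theorem ext_of {S T : B.Trail} (h1 : S.first = T.first) (h2 : S.oedges = T.oedges) : S = T := by
  cases S; cases T; simp only at h1 h2; subst h1; subst h2; rfl

theorem Joins.exists_append {S T : B.Trail} (h : S.Joins T) (hS : S.IsPath) (hT : T.IsPath) :
    ∃ R : B.Trail, R.IsPath ∧ R.first = S.first ∧ R.last = T.last ∧
      R.oedges = S.oedges ++ T.oedges ∧
      ∀ v, v ∈ R.vertices ↔ v ∈ S.vertices ∨ v ∈ T.vertices := by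
  have hT' := List.nodup_cons.1 (show (T.first :: _).Nodup from hT)
  have hn : (S.first :: (S.oedges ++ T.oedges).map OrientedEdge.head).Nodup := by
    rw [List.map_append, ← List.cons_append]
    -- A repeated vertex would be the junction, that is `T.first`, which does not recur in `T`.
    refine List.Nodup.append hS hT'.2 fun v hv hv' => hT'.1 ?_
    rw [← h.last_eq, ← h.inter v hv (List.mem_cons_of_mem _ hv')]
    exact hv'
  have hth : ∀ a ∈ (S.oedges ++ T.oedges).head?, a.tail = S.first := by
    intro a ha
    rw [List.head?_append, Option.mem_def, Option.or_eq_some_iff] at ha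
    rcases ha with ha | ⟨h0, ha⟩
    · exact S.tail_head a ha
    · rw [T.tail_head a ha, ← h.last_eq, last_eq_getLast?, List.head?_eq_none_iff.1 h0]
      rfl
  have hc : (S.oedges ++ T.oedges).IsChain
      fun a b => a.head = b.tail ∧ b.tailSign = -a.headSign := by
    refine List.isChain_append.2 ⟨S.chain, T.chain, fun a ha b hb => ⟨?_, h.signs a ha b hb⟩⟩
    rw [T.tail_head b hb, ← h.last_eq, last_eq_getLast?, Option.mem_def.1 ha]
    rfl
  refine ⟨⟨S.first, S.oedges ++ T.oedges, hth, hc, (edges_nodup_of_vertices_nodup _ _ hth hc hn).1⟩,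
    hn, rfl, ?_, rfl, ?_⟩
  · rw [last_eq_getLast?, last_eq_getLast? T]
    simp only [List.getLast?_append]
    cases h' : T.oedges.getLast? with
    | none => simpa [← last_eq_getLast? S] using h.last_eq
    | some a => simp
  · intro v
    have : T.first ∈ S.vertices := h.last_eq ▸ S.last_mem
    simp only [vertices, List.map_append, List.mem_cons, List.mem_append] at this ⊢
    constructor
    · tauto
    · rintro ((h | h) | (rfl | h)) <;> tauto

/-- The reversed trail. -/
def reverse (T : B.Trail) : B.Trail where
  first := T.last
  oedges := (T.oedges.map OrientedEdge.flip).reverse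
  tail_head := by
    intro a ha
    rw [List.head?_reverse, List.getLast?_map, Option.mem_def, Option.map_eq_some_iff] at ha
    obtain ⟨b, hb, rfl⟩ := ha
    rw [last_eq_getLast?, hb]
    rfl
  chain := by
    rw [List.isChain_reverse, List.isChain_map]
    refine T.chain.imp fun a b hab => ⟨hab.1.symm, ?_⟩
    change a.headSign = -b.tailSign
    rw [hab.2, neg_neg]
  edges_nodup := by
    rw [List.map_reverse, List.nodup_reverse, List.map_map]
    exact T.edges_nodup

theorem reverse_vertices (T : B.Trail) : T.reverse.vertices = T.vertices.reverse := by
  have hl : T.reverse.len = T.len := by simp [len, reverse]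
  apply List.ext_getElem (by rw [List.length_reverse, length_vertices, length_vertices, hl])
  intro i h1 h2
  rw [length_vertices] at h1
  have hi : i ≤ T.len := by omega
  have e1 := vtx_eq_getElem T.reverse (show i ≤ T.reverse.len by omega)
  rw [← e1, List.getElem_reverse]
  have e2 := vtx_eq_getElem T (show T.len - i ≤ T.len by omega)
  have e3 : T.vertices.length - 1 - i = T.len - i := by rw [length_vertices]; omega
  simp only [e3]
  rw [← e2]
  cases i with
  | zero => rw [vtx_zero, Nat.sub_zero, vtx_len]; rfl
  | succ i =>
    rw [← head_getElem T.reverse (by omega), ← tail_getElem T (by omega)]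
    simp only [reverse, List.getElem_reverse, List.getElem_map, List.length_map]
    simp only [OrientedEdge.flip]
    congr 2
    simp only [len]
    omega

theorem reverse_last (T : B.Trail) : T.reverse.last = T.first := by
  unfold last
  simp only [reverse_vertices]
  simp [vertices]

theorem mem_reverse {T : B.Trail} {v : V} : v ∈ T.reverse.vertices ↔ v ∈ T.vertices := by
  rw [reverse_vertices, List.mem_reverse]

theorem IsPath.reverse {T : B.Trail} (hT : T.IsPath) : T.reverse.IsPath := by
  rw [IsPath, reverse_vertices, List.nodup_reverse]
  exact hT

/-- Two paths from distinct vertices of `X` that meet only at their common last vertex, where they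
arrive with opposite signs, form a nontrivial path with both endpoints in `X`. -/
theorem exists_path_of_meet {X : Set V} {S T : B.Trail} (hS : S.IsPath) (hT : T.IsPath)
    (hSX : S.first ∈ X) (hTX : T.first ∈ X) (hne : S.first ≠ T.first) (hlast : S.last = T.last)
    (hsign : ∀ a ∈ S.oedges.getLast?, ∀ b ∈ T.oedges.getLast?, b.headSign = -a.headSign)
    (hinter : ∀ v ∈ S.vertices, v ∈ T.vertices → v = S.last) :
    ∃ R : B.Trail, R.IsPath ∧ ¬ R.IsTrivial ∧ R.first ∈ X ∧ R.last ∈ X := by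
  have hj : S.Joins T.reverse := by
    refine ⟨hlast, fun a ha b hb => ?_, fun v hv hv' => hinter v hv (mem_reverse.1 hv')⟩
    simp only [Trail.reverse] at hb
    rw [List.head?_reverse, List.getLast?_map, Option.mem_def, Option.map_eq_some_iff] at hb
    obtain ⟨c, hc, rfl⟩ := hb
    exact hsign a ha c hc
  obtain ⟨R, h1, h2, h3, -, -⟩ := hj.exists_append hS hT.reverse
  rw [reverse_last] at h3
  refine ⟨R, h1, fun h => hne ?_, h2 ▸ hSX, h3 ▸ hTX⟩
  rw [← h2, ← h3, last_eq_getLast?, show R.oedges = [] from h]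
  rfl

end Trail

end BidirectedGraph

/-! ### Valid choices of initial segments, and a maximal one. -/

namespace BidirectedGraph

open Trail

variable {V E : Type*} {B : BidirectedGraph V E}

/-- For a choice `s` of initial segments of the paths in `𝓟`, the segment of `P` ends at the
`j`-th vertex of `Q`, can be continued along `Q` there, and no initial segment meets `Q` later. -/
structure Held (𝓟 : Set B.Trail) (s : B.Trail → ℕ) (P Q : B.Trail) (j : ℕ) : Prop where
  le : j ≤ Q.len
  eq : P.vtx (s P) = Q.vtx j
  signs : ∀ a ∈ (P.seg 0 (s P)).oedges.getLast?, ∀ b ∈ (Q.seg j Q.len).oedges.head?,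
    b.tailSign = -a.headSign
  top : ∀ P' ∈ 𝓟, ∀ i ≤ s P', ∀ k ≤ Q.len, P'.vtx i = Q.vtx k → k ≤ j

/-- Some chosen initial segment of a path in `𝓟` meets `Q`. -/
def Meets (𝓟 : Set B.Trail) (s : B.Trail → ℕ) (Q : B.Trail) : Prop :=
  ∃ P ∈ 𝓟, ∃ i ≤ s P, ∃ j ≤ Q.len, P.vtx i = Q.vtx j

/-- A choice of initial segments is valid if every path of `𝓠` that meets some of them is held
by one of them. -/
structure Valid (𝓟 𝓠 : Set B.Trail) (s : B.Trail → ℕ) : Prop where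
  le : ∀ T, s T ≤ T.len
  held : ∀ Q ∈ 𝓠, Meets 𝓟 s Q → ∃ P ∈ 𝓟, ∃ j, Held 𝓟 s P Q j

variable {X Y : Set V} {𝓟 𝓠 : Set B.Trail} {s : B.Trail → ℕ} {P Q : B.Trail}

theorem IsDisjointPathSet.eq_of_mem (h : B.IsDisjointPathSet X Y 𝓟) {S T : B.Trail}
    (hS : S ∈ 𝓟) (hT : T ∈ 𝓟) {v : V} (h1 : v ∈ S.vertices) (h2 : v ∈ T.vertices) : S = T := by
  by_contra hne
  exact h.2 hS hT hne v h1 h2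

theorem IsDisjointPathSet.eq_of_vtx (h : B.IsDisjointPathSet X Y 𝓟) {S T : B.Trail}
    (hS : S ∈ 𝓟) (hT : T ∈ 𝓟) {i j : ℕ} (hi : i ≤ S.len) (hj : j ≤ T.len)
    (e : S.vtx i = T.vtx j) : S = T :=
  h.eq_of_mem hS hT (vtx_mem hi) (e ▸ vtx_mem hj)

namespace Trail.IsPathFromTo

theorem eq_zero (h : Q.IsPathFromTo X Y) {k : ℕ} (hk : k ≤ Q.len) (hX : Q.vtx k ∈ X) : k = 0 :=
  h.1.vtx_inj hk (Nat.zero_le _) (by rw [vtx_zero]; exact h.2.1.2 _ (vtx_mem hk) hX)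

theorem eq_len (h : Q.IsPathFromTo X Y) {k : ℕ} (hk : k ≤ Q.len) (hY : Q.vtx k ∈ Y) : k = Q.len :=
  h.1.vtx_inj hk le_rfl (by rw [vtx_len]; exact h.2.2.2 _ (vtx_mem hk) hY)

end Trail.IsPathFromTo

/-- Trivial segments are vertices of `X`, which a path of `𝓠` meets only at its first vertex; the
sign condition is vacuous. -/
theorem valid_zero (hP : B.IsDisjointPathSet X Y 𝓟) (hQ : B.IsDisjointPathSet X Y 𝓠) :
    Valid 𝓟 𝓠 (fun _ => 0) := by
  have key : ∀ Q ∈ 𝓠, ∀ P ∈ 𝓟, ∀ i ≤ 0, ∀ k ≤ Q.len, P.vtx i = Q.vtx k → k = 0 := by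
    intro Q hQ' P hP' i hi k hk e
    obtain rfl : i = 0 := by omega
    refine (hQ.1 Q hQ').eq_zero hk ?_
    rw [← e, vtx_zero]
    exact (hP.1 P hP').2.1.1
  refine ⟨fun _ => Nat.zero_le _, ?_⟩
  rintro Q hQ' ⟨P, hP', i, hi, j, hj, e⟩
  obtain rfl := key Q hQ' P hP' i hi j hj e
  obtain rfl : i = 0 := Nat.le_zero.1 hi
  exact ⟨P, hP', 0, hj, e, by simp [seg],
    fun P' h' i hi k hk e => (key Q hQ' P' h' i hi k hk e).le⟩

/-- Values at `T` are bounded by `T.len`, so each supremum is attained by some member of `c`. Hence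
`c` need not be a chain. -/
theorem valid_sSup (hP : B.IsDisjointPathSet X Y 𝓟) (c : Set (B.Trail → ℕ))
    (hc : ∀ s ∈ c, Valid 𝓟 𝓠 s) (hne : c.Nonempty) :
    ∃ s, Valid 𝓟 𝓠 s ∧ ∀ t ∈ c, t ≤ s := by
  have hb : ∀ T : B.Trail, BddAbove ((fun s : B.Trail → ℕ => s T) '' c) := by
    rintro T
    refine ⟨T.len, ?_⟩
    rintro _ ⟨s, hs, rfl⟩
    exact (hc s hs).le T
  have hub : ∀ t ∈ c, ∀ T, t T ≤ sSup ((fun s : B.Trail → ℕ => s T) '' c) := fun t ht T =>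
    le_csSup (hb T) ⟨t, ht, rfl⟩
  have hatt : ∀ T : B.Trail, ∃ s ∈ c, s T = sSup ((fun s : B.Trail → ℕ => s T) '' c) := fun T =>
    Nat.sSup_mem (hne.image _) (hb T)
  set S : B.Trail → ℕ := fun T => sSup ((fun s : B.Trail → ℕ => s T) '' c) with hS
  have hle : ∀ T, S T ≤ T.len := fun T => by
    obtain ⟨s, hs, e⟩ := hatt T
    exact e.symm.trans_le ((hc s hs).le T)
  refine ⟨S, ⟨hle, ?_⟩, hub⟩
  intro Q hQ' hmeet
  classical
  let p : ℕ → Prop := fun k => k ≤ Q.len ∧ ∃ P ∈ 𝓟, ∃ i ≤ S P, P.vtx i = Q.vtx k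
  have hp : ∃ k ≤ Q.len, p k := by
    obtain ⟨P, hP', i, hi, j, hj, e⟩ := hmeet
    exact ⟨j, hj, hj, P, hP', i, hi, e⟩
  obtain ⟨k0, hk0, hpk0⟩ := hp
  have hk := Nat.findGreatest_spec hk0 hpk0
  have hmax : ∀ k, p k → k ≤ Nat.findGreatest p Q.len := fun k h => Nat.le_findGreatest h.1 h
  obtain ⟨hkQ, P, hP', i, hi, e⟩ := hk
  set k := Nat.findGreatest p Q.len
  -- The choice `s0` already reaches the last met vertex of `Q`, on `P`. Its holder of `Q` must
  -- therefore end there, and is `P` by disjointness.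
  obtain ⟨s0, hs0, es⟩ := hatt P
  obtain ⟨P', hP'', j', hheld⟩ := (hc s0 hs0).held Q hQ' ⟨P, hP', i, by rw [es]; exact hi, k, hkQ, e⟩
  have h1 : k ≤ j' := hheld.top P hP' i (by rw [es]; exact hi) k hkQ e
  have h2 : j' ≤ k := hmax j' ⟨hheld.le, P', hP'', s0 P', hub s0 hs0 P', hheld.eq⟩
  obtain rfl : j' = k := le_antisymm h2 h1
  obtain rfl : P' = P := hP.eq_of_vtx hP'' hP' ((hc s0 hs0).le P') (hi.trans (hle P))
    (hheld.eq.trans e.symm)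
  refine ⟨P', hP', _, hkQ, ?_, ?_, fun P2 h2 i2 hi2 k2 hk2 e2 => hmax k2 ⟨hk2, P2, h2, i2, hi2, e2⟩⟩
  · change P'.vtx (sSup _) = _
    rw [← es]; exact hheld.eq
  · change ∀ a ∈ (P'.seg 0 (sSup _)).oedges.getLast?, _
    rw [← es]; exact hheld.signs

theorem exists_maximal_valid (hP : B.IsDisjointPathSet X Y 𝓟) (hQ : B.IsDisjointPathSet X Y 𝓠) :
    ∃ s, Maximal (Valid 𝓟 𝓠) s := by
  obtain ⟨s, -, hs⟩ := zorn_le_nonempty₀ {s | Valid 𝓟 𝓠 s}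
    (fun c hc _ y hy => valid_sSup hP c hc ⟨y, hy⟩) _ (valid_zero hP hQ)
  exact ⟨s, hs⟩

/-! ### Prolonging a segment that holds nothing. -/

/-- An initial segment can be prolonged to its next vertex if that vertex lies on a path of `𝓠`
beyond all vertices met so far: the signs must then fit, as otherwise one could go back along that
path and along the segment holding it to reach `X` again. -/
theorem Valid.signs_of_new_top
    (hX : ¬ ∃ T : B.Trail, T.IsPath ∧ ¬ T.IsTrivial ∧ T.first ∈ X ∧ T.last ∈ X)
    (hP : B.IsDisjointPathSet X Y 𝓟) (hQ : B.IsDisjointPathSet X Y 𝓠) (hs : Valid 𝓟 𝓠 s)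
    (hPm : P ∈ 𝓟) (hlt : s P < P.len) (hfree : ∀ Q ∈ 𝓠, ∀ j, ¬ Held 𝓟 s P Q j)
    (hQm : Q ∈ 𝓠) {j : ℕ} (e : P.vtx (s P + 1) = Q.vtx j)
    (htop : ∀ P' ∈ 𝓟, ∀ i ≤ s P', ∀ k ≤ Q.len, P'.vtx i = Q.vtx k → k ≤ j) :
    ∀ a ∈ (P.seg 0 (s P + 1)).oedges.getLast?, ∀ b ∈ (Q.seg j Q.len).oedges.head?,
      b.tailSign = -a.headSign := by
  intro a ha b hb
  by_contra hab
  have hPp := hP.1 P hPm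
  have hQp := hQ.1 Q hQm
  have hjl : j < Q.len := by
    by_contra hj
    have h : Q.oedges.length ≤ j := by simpa [len] using hj
    simp [seg, List.drop_eq_nil_of_le (show (Q.oedges.take Q.len).length ≤ j by simp [h])] at hb
  -- Position 0 of `Q` lies in `X`, which `P` meets only at its own first vertex; so some edge of
  -- `Q` arrives at the new vertex.
  obtain ⟨m, rfl⟩ : ∃ m, j = m + 1 := by
    refine Nat.exists_eq_succ_of_ne_zero ?_
    rintro rfl
    have := hPp.eq_zero (show s P + 1 ≤ P.len from hlt)
      (by rw [e, vtx_zero]; exact hQp.2.1.1)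
    omega
  rw [seg_head? _ hjl, Option.mem_def, List.getElem?_eq_some_iff] at hb
  obtain ⟨_, rfl⟩ := hb
  have hm : m < Q.len := by omega
  have hb := tailSign_getElem_succ Q hjl
  -- With only two signs, an edge of `Q` that cannot follow `a` is preceded on `Q` by an edge
  -- arriving with the sign opposite to that of `a`.
  have hc : (Q.oedges[m]'hm).headSign = -a.headSign :=
    Int.units_ne_iff_eq_neg.1 fun h => hab (hb.trans (by rw [h]))
  have hc' : Q.oedges[m]? = some (Q.oedges[m]'hm) := List.getElem?_eq_getElem hm
  have hP1 : (P.seg 0 (s P + 1)).IsPath := hPp.1.seg (Nat.zero_le _) hlt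
  have hl1 : (P.seg 0 (s P + 1)).last = Q.vtx (m + 1) := by
    rw [seg_last P (Nat.zero_le _) hlt, e]
  have hf1 : (P.seg 0 (s P + 1)).first = P.first := by rw [seg_first, vtx_zero]
  -- Such a `T` arrives along `Q` and meets the prolonged segment of `P` only at the new vertex, so
  -- `exists_path_of_meet` contradicts `hX`. If `Q` is met, `T` follows its holder and then `Q`;
  -- otherwise `T` is an initial segment of `Q`.
  suffices ∃ T : B.Trail, T.IsPath ∧ T.first ∈ X ∧ P.first ≠ T.first ∧ T.last = Q.vtx (m + 1) ∧
      T.oedges.getLast? = some (Q.oedges[m]'hm) ∧ ∀ i ≤ s P, P.vtx i ∉ T.vertices by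
    obtain ⟨T, hT1, hT2, hT3, hT4, hT5, hT6⟩ := this
    refine hX (exists_path_of_meet hP1 hT1 (hf1 ▸ hPp.2.1.1) hT2 (hf1 ▸ hT3)
      (hl1.trans hT4.symm) ?_ ?_)
    · intro a' ha' b' hb'
      rw [Option.mem_unique ha' ha]
      rw [hT5, Option.mem_some_iff] at hb'
      rw [← hb', hc]
    · intro v hv hv'
      obtain ⟨k, -, hk, rfl⟩ := (mem_seg (Nat.zero_le _) hlt).1 hv
      rcases Nat.lt_or_ge (s P) k with h | h
      · obtain rfl : k = s P + 1 := by omega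
        rw [hl1, e]
      · exact absurd hv' (hT6 k h)
  by_cases hmeet : Meets 𝓟 s Q
  · obtain ⟨P', hP', j', hh⟩ := hs.held Q hQm hmeet
    have hPP' : P ≠ P' := by
      rintro rfl
      exact hfree Q hQm j' hh
    have hP'p := hP.1 P' hP'
    have hle' := hs.le P'
    have hj' : j' < m + 1 := by
      refine lt_of_le_of_ne (htop P' hP' _ le_rfl _ hh.le hh.eq) ?_
      rintro rfl
      exact hPP' (hP.eq_of_vtx hPm hP' hlt hle' (e.trans hh.eq.symm))
    have hjoin : (P'.seg 0 (s P')).Joins (Q.seg j' (m + 1)) := by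
      refine ⟨?_, ?_, ?_⟩
      · rw [seg_last _ (Nat.zero_le _) hle', seg_first, hh.eq]
      · intro a' ha' b' hb'
        refine hh.signs a' ha' b' ?_
        rwa [seg_head? _ hj', ← seg_head? _ (hj'.trans hjl)] at hb'
      · intro v hv hv'
        obtain ⟨i, -, hi, rfl⟩ := (mem_seg (Nat.zero_le _) hle').1 hv
        obtain ⟨k, hk1, hk2, hk⟩ := (mem_seg hj'.le hjl.le).1 hv'
        have := hh.top P' hP' i hi k (hk2.trans hjl.le) hk.symm
        obtain rfl : k = j' := by omega
        rw [seg_last _ (Nat.zero_le _) hle', hh.eq, hk]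
    obtain ⟨T, hT1, hT2, hT3, hT4, hT5⟩ := hjoin.exists_append
      (hP'p.1.seg (Nat.zero_le _) hle') (hQp.1.seg hj'.le hjl.le)
    rw [seg_first, vtx_zero] at hT2
    refine ⟨T, hT1, hT2 ▸ hP'p.2.1.1, fun h => hPP' ?_, ?_, ?_, ?_⟩
    · exact hP.eq_of_mem hPm hP' (first_mem P) (by rw [h, hT2]; exact first_mem P')
    · rw [hT3, seg_last _ hj'.le hjl.le]
    · rw [hT4, List.getLast?_append, seg_getLast? _ (by omega) hm, hc']
      rfl
    · intro i hi hv
      rcases (hT5 _).1 hv with hv | hv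
      · exact hPP' (hP.eq_of_mem hPm hP' (vtx_mem (hi.trans (hs.le P)))
          (mem_of_mem_seg (Nat.zero_le _) hle' hv))
      · obtain ⟨k, hk1, hk2, hk⟩ := (mem_seg hj'.le hjl.le).1 hv
        have := hh.top P hPm i hi k (hk2.trans hjl.le) hk.symm
        obtain rfl : k = j' := by omega
        exact hPP' (hP.eq_of_vtx hPm hP' (hi.trans (hs.le P)) hle' (hk.symm.trans hh.eq.symm))
  · have h6 : ∀ i ≤ s P, P.vtx i ∉ (Q.seg 0 (m + 1)).vertices := by
      intro i hi hv
      obtain ⟨k, -, hk2, hk⟩ := (mem_seg (Nat.zero_le _) hjl.le).1 hv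
      exact hmeet ⟨P, hPm, i, hi, k, hk2.trans hjl.le, hk.symm⟩
    refine ⟨Q.seg 0 (m + 1), hQp.1.seg (Nat.zero_le _) hjl.le, ?_, ?_, ?_, ?_, h6⟩
    · rw [seg_first, vtx_zero]; exact hQp.2.1.1
    · intro h
      refine h6 0 (Nat.zero_le _) ?_
      rw [vtx_zero, h]
      exact first_mem _
    · exact seg_last _ (Nat.zero_le _) hjl.le
    · rw [seg_getLast? _ (Nat.zero_le _) hm, hc']

/-- If the new vertex lies on `Q` at or beyond every met vertex, `P` becomes the holder of `Q`.
Otherwise the old holder remains; it is not `P`, so its segment is unchanged. -/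
theorem Valid.update
    (hX : ¬ ∃ T : B.Trail, T.IsPath ∧ ¬ T.IsTrivial ∧ T.first ∈ X ∧ T.last ∈ X)
    (hP : B.IsDisjointPathSet X Y 𝓟) (hQ : B.IsDisjointPathSet X Y 𝓠) (hs : Valid 𝓟 𝓠 s)
    (hPm : P ∈ 𝓟) (hlt : s P < P.len) (hfree : ∀ Q ∈ 𝓠, ∀ j, ¬ Held 𝓟 s P Q j)
    [DecidableEq B.Trail] :
    Valid 𝓟 𝓠 (Function.update s P (s P + 1)) := by
  set s' := Function.update s P (s P + 1) with hs'
  have e1 : s' P = s P + 1 := Function.update_self ..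
  have e2 : ∀ T, T ≠ P → s' T = s T := fun T h => Function.update_of_ne h ..
  have hcase : ∀ T, ∀ i ≤ s' T, i ≤ s T ∨ (T = P ∧ i = s P + 1) := by
    intro T i hi
    by_cases h : T = P
    · subst h
      rw [e1] at hi
      rcases Nat.lt_or_ge (s T) i with h | h
      · exact Or.inr ⟨rfl, by omega⟩
      · exact Or.inl h
    · rw [e2 T h] at hi
      exact Or.inl hi
  refine ⟨fun T => ?_, fun Q hQm hmeet => ?_⟩
  · by_cases h : T = P
    · rw [h, e1]; exact hlt
    · rw [e2 T h]; exact hs.le T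
  by_cases hnew : ∃ j ≤ Q.len, P.vtx (s P + 1) = Q.vtx j ∧
      ∀ P' ∈ 𝓟, ∀ i ≤ s P', ∀ k ≤ Q.len, P'.vtx i = Q.vtx k → k ≤ j
  · obtain ⟨j, hj, e, htop⟩ := hnew
    refine ⟨P, hPm, j, hj, by rw [e1, e], ?_, ?_⟩
    · rw [e1]
      exact hs.signs_of_new_top hX hP hQ hPm hlt hfree hQm e htop
    · intro P' hP' i hi k hk ek
      rcases hcase P' i hi with h | ⟨rfl, rfl⟩
      · exact htop P' hP' i h k hk ek
      · exact ((hQ.1 Q hQm).1.vtx_inj hk hj (ek.symm.trans e)).le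
  -- If the new vertex lies on `Q`, an old segment meets `Q` strictly later. So `Q` was met before
  -- and its last met vertex does not move.
  · push Not at hnew
    have hm : Meets 𝓟 s Q := by
      obtain ⟨P', hP', i, hi, j, hj, e⟩ := hmeet
      rcases hcase P' i hi with h | ⟨rfl, rfl⟩
      · exact ⟨P', hP', i, h, j, hj, e⟩
      · obtain ⟨P2, hP2, i2, hi2, k2, hk2, ek2, -⟩ := hnew j hj e
        exact ⟨P2, hP2, i2, hi2, k2, hk2, ek2⟩
    obtain ⟨P', hP', j', hh⟩ := hs.held Q hQm hm
    have hne : P' ≠ P := by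
      rintro rfl
      exact hfree Q hQm j' hh
    refine ⟨P', hP', j', hh.le, by rw [e2 P' hne]; exact hh.eq,
      by rw [e2 P' hne]; exact hh.signs, ?_⟩
    intro P3 hP3 i hi k hk ek
    rcases hcase P3 i hi with h | ⟨rfl, rfl⟩
    · exact hh.top P3 hP3 i h k hk ek
    · obtain ⟨P2, hP2, i2, hi2, k2, hk2, ek2, hlt2⟩ := hnew k hk ek
      exact hlt2.le.trans (hh.top P2 hP2 i2 hi2 k2 hk2 ek2)

theorem Valid.eq_len_of_maximal
    (hX : ¬ ∃ T : B.Trail, T.IsPath ∧ ¬ T.IsTrivial ∧ T.first ∈ X ∧ T.last ∈ X)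
    (hP : B.IsDisjointPathSet X Y 𝓟) (hQ : B.IsDisjointPathSet X Y 𝓠)
    (hs : Maximal (Valid 𝓟 𝓠) s) (hPm : P ∈ 𝓟) (hfree : ∀ Q ∈ 𝓠, ∀ j, ¬ Held 𝓟 s P Q j) :
    s P = P.len := by
  classical
  refine le_antisymm (hs.prop.le P) (Nat.le_of_not_lt fun hlt => ?_)
  have h := hs.le_of_ge (hs.prop.update hX hP hQ hPm hlt hfree)
    (le_update_iff.2 ⟨Nat.le_succ _, fun _ _ => le_rfl⟩) P
  rw [Function.update_self] at h
  exact Nat.not_succ_le_self _ h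

/-! ### Splices and their disjointness. -/

/-- The trail `R` follows the initial segment of `P` and then `Q` from its `j`-th vertex on. -/
structure IsSplice (s : B.Trail → ℕ) (P Q : B.Trail) (j : ℕ) (R : B.Trail) : Prop where
  first : R.first = P.first
  last : R.last = Q.last
  oedges : R.oedges = (P.seg 0 (s P)).oedges ++ (Q.seg j Q.len).oedges
  mem : ∀ v, v ∈ R.vertices ↔ v ∈ (P.seg 0 (s P)).vertices ∨ v ∈ (Q.seg j Q.len).vertices

/-- No segment meets `Q` beyond position `j`, so only the junction remains. -/
theorem Held.vtx_eq {j : ℕ} (hh : Held 𝓟 s P Q j) {P' : B.Trail} (hP' : P' ∈ 𝓟) {i : ℕ}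
    (hi : i ≤ s P') (hv : P'.vtx i ∈ (Q.seg j Q.len).vertices) : P'.vtx i = P.vtx (s P) := by
  obtain ⟨k, hk1, hk2, hk⟩ := (mem_seg hh.le le_rfl).1 hv
  have := hh.top P' hP' i hi k hk2 hk.symm
  obtain rfl : k = j := by omega
  rw [hh.eq, hk]

theorem Held.exists_splice (hle : s P ≤ P.len) (hPm : P ∈ 𝓟) (hPp : P.IsPathFromTo X Y)
    (hQp : Q.IsPathFromTo X Y) {j : ℕ} (hh : Held 𝓟 s P Q j) :
    ∃ R : B.Trail, R.IsPathFromTo X Y ∧ IsSplice s P Q j R := by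
  have hl : (P.seg 0 (s P)).last = P.vtx (s P) := seg_last _ (Nat.zero_le _) hle
  have hjoin : (P.seg 0 (s P)).Joins (Q.seg j Q.len) := by
    refine ⟨by rw [hl, seg_first, hh.eq], hh.signs, ?_⟩
    intro v hv hv'
    obtain ⟨i, -, hi, rfl⟩ := (mem_seg (Nat.zero_le _) hle).1 hv
    rw [hl, hh.vtx_eq hPm hi hv']
  obtain ⟨R, h1, h2, h3, h4, h5⟩ := hjoin.exists_append
    (hPp.1.seg (Nat.zero_le _) hle) (hQp.1.seg hh.le le_rfl)
  rw [seg_first, vtx_zero] at h2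
  rw [seg_last _ hh.le le_rfl, vtx_len] at h3
  refine ⟨R, ⟨h1, ⟨h2 ▸ hPp.2.1.1, fun v hv hvX => ?_⟩, ⟨h3 ▸ hQp.2.2.1, fun v hv hvY => ?_⟩⟩,
    h2, h3, h4, h5⟩
  · rw [h2]
    rcases (h5 v).1 hv with hv | hv
    · exact hPp.2.1.2 v (mem_of_mem_seg (Nat.zero_le _) hle hv) hvX
    -- A vertex of `X` on the `Q` part is at position 0, hence is the junction, which also lies on
    -- `P`. The argument for `Y` is symmetric.
    · obtain ⟨k, hk1, hk2, rfl⟩ := (mem_seg hh.le le_rfl).1 hv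
      have := hQp.eq_zero hk2 hvX
      obtain rfl : k = j := by omega
      rw [← hh.eq] at hvX ⊢
      exact hPp.2.1.2 _ (vtx_mem hle) hvX
  · rw [h3]
    rcases (h5 v).1 hv with hv | hv
    · obtain ⟨k, -, hk, rfl⟩ := (mem_seg (Nat.zero_le _) hle).1 hv
      have := hPp.eq_len (hk.trans hle) hvY
      obtain rfl : k = s P := by omega
      rw [hh.eq] at hvY ⊢
      exact hQp.2.2.2 _ (vtx_mem hh.le) hvY
    · exact hQp.2.2.2 v (mem_of_mem_seg hh.le le_rfl hv) hvY

/-- A common vertex forces the same holder: a segment meets the `Q` part of a splice only at its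
junction, and two splices sharing a vertex on their `Q` parts use the same `Q` with the same last
met vertex. The holder's end then determines `Q` and `j`. -/
theorem Held.splice_eq (hP : B.IsDisjointPathSet X Y 𝓟) (hQ : B.IsDisjointPathSet X Y 𝓠)
    (hs : Valid 𝓟 𝓠 s) {P' Q' R R' : B.Trail} {j j' : ℕ} (hPm : P ∈ 𝓟) (hQm : Q ∈ 𝓠)
    (hPm' : P' ∈ 𝓟) (hQm' : Q' ∈ 𝓠) (hh : Held 𝓟 s P Q j) (hh' : Held 𝓟 s P' Q' j')
    (hR : IsSplice s P Q j R) (hR' : IsSplice s P' Q' j' R') {v : V} (hv : v ∈ R.vertices)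
    (hv' : v ∈ R'.vertices) : R = R' := by
  have hle := hs.le P
  have hle' := hs.le P'
  have hPP : P = P' := by
    rcases (hR.mem v).1 hv with h | h <;> rcases (hR'.mem v).1 hv' with h' | h'
    · exact hP.eq_of_mem hPm hPm' (mem_of_mem_seg (Nat.zero_le _) hle h)
        (mem_of_mem_seg (Nat.zero_le _) hle' h')
    · obtain ⟨i, -, hi, rfl⟩ := (mem_seg (Nat.zero_le _) hle).1 h
      exact hP.eq_of_vtx hPm hPm' (hi.trans hle) hle' (hh'.vtx_eq hPm hi h')
    · obtain ⟨i, -, hi, rfl⟩ := (mem_seg (Nat.zero_le _) hle').1 h'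
      exact (hP.eq_of_vtx hPm' hPm (hi.trans hle') hle (hh.vtx_eq hPm' hi h)).symm
    · obtain rfl : Q = Q' := hQ.eq_of_mem hQm hQm' (mem_of_mem_seg hh.le le_rfl h)
        (mem_of_mem_seg hh'.le le_rfl h')
      have h1 := hh.top P' hPm' _ le_rfl _ hh'.le hh'.eq
      have h2 := hh'.top P hPm _ le_rfl _ hh.le hh.eq
      obtain rfl : j = j' := by omega
      exact hP.eq_of_vtx hPm hPm' hle hle' (hh.eq.trans hh'.eq.symm)
  subst hPP
  have e : Q.vtx j = Q'.vtx j' := hh.eq.symm.trans hh'.eq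
  obtain rfl : Q = Q' := hQ.eq_of_vtx hQm hQm' hh.le hh'.le e
  obtain rfl : j = j' := (hQ.1 Q hQm).1.vtx_inj hh.le hh'.le e
  exact ext_of (hR.first.trans hR'.first.symm) (hR.oedges.trans hR'.oedges.symm)

end BidirectedGraph

/-! ### Assembling the family. -/

open BidirectedGraph Trail in
theorem mainTheorem10 {V E : Type*} (B : BidirectedGraph V E) (X Y : Set V)
    (hX : ¬ ∃ T : B.Trail, T.IsPath ∧ ¬ T.IsTrivial ∧ T.first ∈ X ∧ T.last ∈ X)
    (𝓟 𝓠 : Set B.Trail)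
    (hP : B.IsDisjointPathSet X Y 𝓟) (hQ : B.IsDisjointPathSet X Y 𝓠) :
    ∃ 𝓡 : Set B.Trail, B.IsDisjointPathSet X Y 𝓡 ∧
      BidirectedGraph.Trail.first '' 𝓟 ⊆ BidirectedGraph.Trail.first '' 𝓡 ∧
      BidirectedGraph.Trail.last '' 𝓠 ⊆ BidirectedGraph.Trail.last '' 𝓡 := by
  obtain ⟨s, hmax⟩ := exists_maximal_valid hP hQ
  have hs := hmax.prop
  -- Paths in `𝓑` equal their chosen segments by maximality, so they avoid `𝓒` by definition and
  -- could meet a splice's `Q` part only at its junction, which lies on another path of `𝓟`.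
  let 𝓐 : Set B.Trail := {R | R.IsPathFromTo X Y ∧
    ∃ P ∈ 𝓟, ∃ Q ∈ 𝓠, ∃ j, Held 𝓟 s P Q j ∧ IsSplice s P Q j R}
  let 𝓑 : Set B.Trail := {R | R ∈ 𝓟 ∧ ∀ Q ∈ 𝓠, ∀ j, ¬ Held 𝓟 s R Q j}
  let 𝓒 : Set B.Trail := {R | R ∈ 𝓠 ∧ ¬ Meets 𝓟 s R}
  have hsplice : ∀ P ∈ 𝓟, ∀ Q ∈ 𝓠, ∀ j, Held 𝓟 s P Q j →
      ∃ R ∈ 𝓐, R.first = P.first ∧ R.last = Q.last := by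
    intro P hPm Q hQm j hh
    obtain ⟨R, h1, h2⟩ := hh.exists_splice (hs.le P) hPm (hP.1 P hPm) (hQ.1 Q hQm)
    exact ⟨R, ⟨h1, P, hPm, Q, hQm, j, hh, h2⟩, h2.first, h2.last⟩
  have hlen : ∀ R ∈ 𝓑, s R = R.len := fun R hR =>
    Valid.eq_len_of_maximal hX hP hQ hmax hR.1 hR.2
  have hsymm : Std.Symm fun S T : B.Trail => ∀ v ∈ S.vertices, v ∉ T.vertices :=
    ⟨fun _ _ h v hv hv' => h v hv' hv⟩
  refine ⟨𝓐 ∪ (𝓑 ∪ 𝓒), ⟨?_, ?_⟩, ?_, ?_⟩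
  · rintro R (h | h | h)
    · exact h.1
    · exact hP.1 R h.1
    · exact hQ.1 R h.1
  · rw [Set.pairwise_union_of_symm, Set.pairwise_union_of_symm]
    refine ⟨?_, ⟨hP.2.mono fun R h => h.1, hQ.2.mono fun R h => h.1, ?_⟩, ?_⟩
    · rintro R ⟨-, P, hPm, Q, hQm, j, hh, hR⟩ R' ⟨-, P', hPm', Q', hQm', j', hh', hR'⟩ hne v hv hv'
      exact hne (hh.splice_eq hP hQ hs hPm hQm hPm' hQm' hh' hR hR' hv hv')
    · rintro R hR R' hR' - v hv hv'
      obtain ⟨i, hi, rfl⟩ := mem_vertices_iff.1 hv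
      obtain ⟨k, hk, hk'⟩ := mem_vertices_iff.1 hv'
      exact hR'.2 ⟨R, hR.1, i, by rw [hlen R hR]; exact hi, k, hk, hk'.symm⟩
    · rintro R ⟨-, P, hPm, Q, hQm, j, hh, hR⟩ R' (hR' | hR') - v hv hv'
      · have hne : P ≠ R' := by
          rintro rfl
          exact hR'.2 Q hQm j hh
        rcases (hR.mem v).1 hv with h | h
        · exact hne (hP.eq_of_mem hPm hR'.1 (mem_of_mem_seg (Nat.zero_le _) (hs.le P) h) hv')
        · obtain ⟨i, hi, rfl⟩ := mem_vertices_iff.1 hv'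
          exact hne (hP.eq_of_vtx hPm hR'.1 (hs.le P) hi
            (hh.vtx_eq hR'.1 (by rw [hlen R' hR']; exact hi) h).symm)
      · rcases (hR.mem v).1 hv with h | h
        · obtain ⟨i, -, hi, rfl⟩ := (mem_seg (Nat.zero_le _) (hs.le P)).1 h
          obtain ⟨k, hk, hk'⟩ := mem_vertices_iff.1 hv'
          exact hR'.2 ⟨P, hPm, i, hi, k, hk, hk'.symm⟩
        · obtain rfl := hQ.eq_of_mem hQm hR'.1 (mem_of_mem_seg hh.le le_rfl h) hv'
          exact hR'.2 ⟨P, hPm, s P, le_rfl, j, hh.le, hh.eq⟩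
  · rintro _ ⟨P, hPm, rfl⟩
    by_cases h : ∀ Q ∈ 𝓠, ∀ j, ¬ Held 𝓟 s P Q j
    · exact ⟨P, Or.inr (Or.inl ⟨hPm, h⟩), rfl⟩
    · push Not at h
      obtain ⟨Q, hQm, j, hh⟩ := h
      obtain ⟨R, hR, h1, -⟩ := hsplice P hPm Q hQm j hh
      exact ⟨R, Or.inl hR, h1⟩
  · rintro _ ⟨Q, hQm, rfl⟩
    by_cases h : Meets 𝓟 s Q
    · obtain ⟨P, hPm, j, hh⟩ := hs.held Q hQm h
      obtain ⟨R, hR, -, h1⟩ := hsplice P hPm Q hQm j hh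
      exact ⟨R, Or.inl hR, h1⟩
    · exact ⟨Q, Or.inr (Or.inr ⟨hQm, h⟩), rfl⟩
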